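/- Let $V$ be Thompson's group: the group, under composition, of all bijections $f:[0,1)\to[0,1)$ that are right-continuous and piecewise affine with finitely many breakpoints, all of them dyadic rationals, such that the slope of every affine piece is $2^k$ for some $k\in\mathbb{Z}$, and that map dyadic rationals to dyadic rationals. **Theorem 4.4.** $V$ has Serre's property FA: whenever $V$ acts by simplicial automorphisms on a (non-empty) simplicial tree $\Gamma$, possibly with inversions of edges, the action has a global fixed point, i.e. there is a point $p$ of the geometric realization of $\Gamma$ (a vertex or a point of an edge) with $g\cdot p=p$ for all $g\in V$. -/

import Mathlib

universe v u

/-! ### Simplicial trees, simplicial actions, and property FA -/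

/-- A point of the geometric realization of a graph `Γ` (a one-dimensional simplicial complex), in
barycentric coordinates: a convex combination of vertices which is supported on a single vertex or
on the two end points of a single edge. -/
@[ext]
structure GraphPoint {X : Type*} (Γ : SimpleGraph X) where
  /-- the barycentric coordinates -/
  coord : X →₀ ℝ
  nonneg : ∀ v, 0 ≤ coord v
  total : (coord.sum fun _ r => r) = 1
  simplex : (∃ v, (coord.support : Set X) ⊆ {v}) ∨
    ∃ v w, Γ.Adj v w ∧ (coord.support : Set X) ⊆ {v, w}

/-- The action of a simplicial automorphism on the geometric realization: the linear extension of
its action on the vertices. -/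
noncomputable def GraphPoint.map {X : Type*} {Γ : SimpleGraph X} (φ : Γ ≃g Γ)
    (p : GraphPoint Γ) : GraphPoint Γ where
  coord := p.coord.equivMapDomain φ.toEquiv
  nonneg v := by simpa using p.nonneg _
  total := by
    rw [Finsupp.sum_equivMapDomain]
    exact p.total
  simplex := by
    have key : ∀ s : Set X, (p.coord.support : Set X) ⊆ s →
        ((p.coord.equivMapDomain φ.toEquiv).support : Set X) ⊆ φ '' s := by
      intro s hs v hv
      refine ⟨φ.symm v, hs ?_, by simp⟩
      rw [Finset.mem_coe, Finsupp.mem_support_iff] at hv ⊢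
      exact hv
    rcases p.simplex with ⟨v, hv⟩ | ⟨v, w, hvw, h⟩
    · exact Or.inl ⟨φ v, by simpa using key _ hv⟩
    · exact Or.inr ⟨φ v, φ w, φ.map_rel_iff.2 hvw, by simpa [Set.image_pair] using key _ h⟩

/-- Serre's property FA: every action of `G` by simplicial automorphisms on a simplicial tree `Γ`
(inversions of edges are allowed) fixes a point of the geometric realization of `Γ`. -/
def HasPropertyFA (G : Type v) [Group G] : Prop :=
  ∀ (X : Type u) (Γ : SimpleGraph X), Γ.IsTree →
    ∀ ρ : G →* (Γ ≃g Γ), ∃ p : GraphPoint Γ, ∀ g : G, p.map (ρ g) = p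

/-! ### Thompson's group `V` -/

/-- Dyadic rational numbers. -/
def IsDyadic (x : ℝ) : Prop := ∃ (m : ℤ) (n : ℕ), x = m / 2 ^ n

/-- A self-map of `[0, 1)` which is affine between consecutive points of a finite set `B` of dyadic
breakpoints, where each affine piece `t ↦ 2 ^ k * t + c` has slope an integral power of `2` and maps
dyadic rationals to dyadic rationals (that is, `c` is dyadic). A piece contains its left end point
and not its right one, so that such a map is right-continuous. -/
def IsPiecewiseDyadic (f : Set.Ico (0 : ℝ) 1 → Set.Ico (0 : ℝ) 1) : Prop :=
  ∃ B : Finset ℝ, (∀ b ∈ B, IsDyadic b) ∧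
    ∀ s : Set.Ico (0 : ℝ) 1, ∃ (k : ℤ) (c : ℝ), IsDyadic c ∧
      ∀ t : Set.Ico (0 : ℝ) 1, s ≤ t → (∀ b ∈ B, b ∉ Set.Ioc (s : ℝ) t) →
        (f t : ℝ) = 2 ^ k * (t : ℝ) + c

theorem IsDyadic.neg {x : ℝ} (hx : IsDyadic x) : IsDyadic (-x) := by
  obtain ⟨m, n, rfl⟩ := hx
  exact ⟨-m, n, by push_cast; ring⟩

theorem IsDyadic.add {x y : ℝ} (hx : IsDyadic x) (hy : IsDyadic y) : IsDyadic (x + y) := by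
  obtain ⟨m, n, rfl⟩ := hx
  obtain ⟨m', n', rfl⟩ := hy
  exact ⟨m * 2 ^ n' + m' * 2 ^ n, n + n', by push_cast; field_simp; try ring⟩

theorem IsDyadic.zpow_mul {x : ℝ} (hx : IsDyadic x) (k : ℤ) : IsDyadic (2 ^ k * x) := by
  obtain ⟨m, n, rfl⟩ := hx
  obtain ⟨j, rfl | rfl⟩ := k.eq_nat_or_neg
  · exact ⟨2 ^ j * m, n, by push_cast; rw [zpow_natCast]; ring⟩
  · exact ⟨m, n + j, by rw [zpow_neg, zpow_natCast]; field_simp; try ring⟩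

theorem isPiecewiseDyadic_id : IsPiecewiseDyadic id :=
  ⟨∅, by simp, fun _ => ⟨0, 0, ⟨0, 0, by simp⟩, by simp⟩⟩

theorem IsPiecewiseDyadic.comp {f g : Equiv.Perm (Set.Ico (0 : ℝ) 1)}
    (hf : IsPiecewiseDyadic f) (hg : IsPiecewiseDyadic g) :
    IsPiecewiseDyadic (f * g : Equiv.Perm (Set.Ico (0 : ℝ) 1)) := by
  classical
  obtain ⟨B, hB, hf⟩ := hf
  obtain ⟨C, hC, hg⟩ := hg
  refine ⟨C ∪ B.image fun b => if h : b ∈ Set.Ico (0 : ℝ) 1 then (g.symm ⟨b, h⟩ : ℝ) else 0,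
    ?_, ?_⟩
  · intro x hx
    rcases Finset.mem_union.1 hx with hx | hx
    · exact hC x hx
    · obtain ⟨b, hb, rfl⟩ := Finset.mem_image.1 hx
      split_ifs with h
      · obtain ⟨k, c, hc, h1⟩ := hg (g.symm ⟨b, h⟩)
        have h2 := h1 (g.symm ⟨b, h⟩) le_rfl (by simp)
        simp only [Equiv.apply_symm_apply] at h2
        have h3 : (g.symm ⟨b, h⟩ : ℝ) = 2 ^ (-k) * (b + -c) := by
          have h4 : b + -c = 2 ^ k * (g.symm ⟨b, h⟩ : ℝ) := by linarith
          rw [h4, zpow_neg, inv_mul_cancel_left₀ (by positivity)]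
        rw [h3]
        exact ((hB b hb).add hc.neg).zpow_mul _
      · exact ⟨0, 0, by simp⟩
  · intro s
    obtain ⟨k, c, hc, h1⟩ := hg s
    obtain ⟨l, d, hd, h2⟩ := hf (g s)
    refine ⟨l + k, 2 ^ l * c + d, (hc.zpow_mul l).add hd, ?_⟩
    intro t hst ht
    have pk : (0 : ℝ) < 2 ^ k := by positivity
    have e1 := h1 t hst fun b hb => ht b (Finset.mem_union_left _ hb)
    have e0 := h1 s le_rfl (by simp)
    have hst' : (s : ℝ) ≤ t := hst
    have e2 := h2 (g t) (show (g s : ℝ) ≤ g t by rw [e0, e1]; gcongr) (by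
      intro b hb hbm
      have hb01 : b ∈ Set.Ico (0 : ℝ) 1 :=
        ⟨(g s).2.1.trans hbm.1.le, hbm.2.trans_lt (g t).2.2⟩
      obtain ⟨r, hr⟩ : ∃ r, r = (b - c) / 2 ^ k := ⟨_, rfl⟩
      have hbr : b = 2 ^ k * r + c := by rw [hr]; field_simp; ring
      have hr1 : (s : ℝ) < r := by
        have := hbm.1
        rw [e0, hbr] at this
        exact lt_of_mul_lt_mul_left (by linarith) pk.le
      have hr2 : r ≤ t := by
        have := hbm.2
        rw [e1, hbr] at this
        exact le_of_mul_le_mul_left (by linarith) pk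
      have hr01 : r ∈ Set.Ico (0 : ℝ) 1 := ⟨s.2.1.trans hr1.le, hr2.trans_lt t.2.2⟩
      have e3 := h1 ⟨r, hr01⟩ hr1.le fun b' hb' hm =>
        ht b' (Finset.mem_union_left _ hb') ⟨hm.1, hm.2.trans hr2⟩
      have e4 : g ⟨r, hr01⟩ = ⟨b, hb01⟩ := Subtype.ext (e3.trans hbr.symm)
      refine ht r (Finset.mem_union_right _ (Finset.mem_image.2 ⟨b, hb, ?_⟩)) ⟨hr1, hr2⟩
      rw [dif_pos hb01, ← e4, Equiv.symm_apply_apply])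
    rw [Equiv.Perm.mul_apply, e2, e1, zpow_add₀ (by norm_num)]
    ring

theorem IsPiecewiseDyadic.inv {f : Equiv.Perm (Set.Ico (0 : ℝ) 1)}
    (hf : IsPiecewiseDyadic f) : IsPiecewiseDyadic (f⁻¹ : Equiv.Perm (Set.Ico (0 : ℝ) 1)) := by
  classical
  obtain ⟨B, hB, hf⟩ := hf
  refine ⟨(insert 0 B).image fun b => if h : b ∈ Set.Ico (0 : ℝ) 1 then (f ⟨b, h⟩ : ℝ) else 0,
    ?_, ?_⟩
  · intro x hx
    obtain ⟨b, hb, rfl⟩ := Finset.mem_image.1 hx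
    have hbd : IsDyadic b := by
      rcases Finset.mem_insert.1 hb with rfl | hb
      · exact ⟨0, 0, by simp⟩
      · exact hB b hb
    split_ifs with h
    · obtain ⟨k, c, hc, h1⟩ := hf ⟨b, h⟩
      rw [h1 ⟨b, h⟩ le_rfl (by simp)]
      exact (hbd.zpow_mul k).add hc
    · exact ⟨0, 0, by simp⟩
  · intro y
    obtain ⟨s, rfl⟩ := f.surjective y
    obtain ⟨k, c, hc, h1⟩ := hf s
    refine ⟨-k, 2 ^ (-k) * -c, hc.neg.zpow_mul _, ?_⟩
    intro u hyu hu
    obtain ⟨t, rfl⟩ := f.surjective u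
    have hinv : (f⁻¹ : Equiv.Perm (Set.Ico (0 : ℝ) 1)) (f t) = t := f.symm_apply_apply t
    rw [hinv]
    have pk : (0 : ℝ) < 2 ^ k := by positivity
    have e0 := h1 s le_rfl (by simp)
    -- the end point of the affine piece which starts at `s`
    obtain ⟨b, hsb, hb, hlow⟩ : ∃ b : ℝ, (s : ℝ) < b ∧ (b = 1 ∨ b ∈ B ∧ b < 1) ∧
        ∀ x : ℝ, (s : ℝ) ≤ x → x < b → ∀ b' ∈ B, b' ∉ Set.Ioc (s : ℝ) x := by
      have hne : (insert 1 (B.filter fun b => (s : ℝ) < b ∧ b < 1)).Nonempty :=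
        Finset.insert_nonempty _ _
      refine ⟨(insert 1 (B.filter fun b => (s : ℝ) < b ∧ b < 1)).min' hne, ?_, ?_, ?_⟩
      · rw [Finset.lt_min'_iff]
        intro x hx
        rcases Finset.mem_insert.1 hx with rfl | hx
        · exact s.2.2
        · exact (Finset.mem_filter.1 hx).2.1
      · rcases Finset.mem_insert.1 (Finset.min'_mem _ hne) with h | h
        · exact Or.inl h
        · exact Or.inr ⟨(Finset.mem_filter.1 h).1, (Finset.mem_filter.1 h).2.2⟩
      · intro x _ hx b' hb' hm
        have h1' : x < 1 := hx.trans_le (Finset.min'_le _ _ (Finset.mem_insert_self _ _))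
        have := Finset.min'_le (insert 1 (B.filter fun b => (s : ℝ) < b ∧ b < 1)) b'
          (Finset.mem_insert_of_mem (Finset.mem_filter.2 ⟨hb', hm.1, hm.2.trans_lt h1'⟩))
        exact absurd hm.2 (not_le.2 (hx.trans_le this))
    have hb1 : b ≤ 1 := by rcases hb with h | h; exacts [h.le, h.2.le]
    have aff : ∀ x : ℝ, ∀ hx : x ∈ Set.Ico (0 : ℝ) 1, (s : ℝ) ≤ x → x < b →
        (f ⟨x, hx⟩ : ℝ) = 2 ^ k * x + c := fun x hx h h' => h1 ⟨x, hx⟩ h (hlow x h h')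
    have hst' : (f s : ℝ) ≤ f t := hyu
    obtain ⟨r, hr⟩ : ∃ r, r = ((f t : ℝ) - c) / 2 ^ k := ⟨_, rfl⟩
    have htr : (f t : ℝ) = 2 ^ k * r + c := by rw [hr]; field_simp; ring
    have hsr : (s : ℝ) ≤ r := by
      rw [e0, htr] at hst'
      exact le_of_mul_le_mul_left (by linarith) pk
    by_cases hrb : r < b
    · have hr01 : r ∈ Set.Ico (0 : ℝ) 1 := ⟨s.2.1.trans hsr, hrb.trans_le hb1⟩
      have : f ⟨r, hr01⟩ = f t := Subtype.ext (by rw [aff r hr01 hsr hrb, htr])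
      have := f.injective this
      rw [← this, aff r hr01 hsr hrb, zpow_neg]
      field_simp
      ring
    · exfalso
      push Not at hrb
      have hw1 : (f s : ℝ) < 2 ^ k * b + c := by rw [e0]; gcongr
      have hw2 : 2 ^ k * b + c ≤ (f t : ℝ) := by rw [htr]; gcongr
      have hw01 : 2 ^ k * b + c ∈ Set.Ico (0 : ℝ) 1 :=
        ⟨(f s).2.1.trans hw1.le, hw2.trans_lt (f t).2.2⟩
      obtain ⟨q, hq⟩ := f.surjective ⟨2 ^ k * b + c, hw01⟩
      have hqv : (f q : ℝ) = 2 ^ k * b + c := by rw [hq]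
      have hqB : (q : ℝ) ∉ insert 0 B := by
        intro h
        refine hu _ (Finset.mem_image.2 ⟨q, h, rfl⟩) ?_
        rw [dif_pos q.2]
        exact ⟨by rw [hqv]; exact hw1, by rw [hqv]; exact hw2⟩
      have hq0 : (0 : ℝ) < q :=
        lt_of_le_of_ne q.2.1 fun h => hqB (h ▸ Finset.mem_insert_self _ _)
      have hqb : (q : ℝ) ≠ b := by
        intro h
        rcases hb with hb | hb
        · exact absurd q.2.2 (by rw [h, hb]; exact lt_irrefl _)
        · exact hqB (h ▸ Finset.mem_insert_of_mem hb.1)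
      -- the last breakpoint before `q`
      obtain ⟨a, ha0, haq, ha⟩ : ∃ a : ℝ, 0 ≤ a ∧ a < q ∧ ∀ b' ∈ B, b' ∉ Set.Ioc a q := by
        have hne : (insert 0 (B.filter fun b => 0 < b ∧ b < (q : ℝ))).Nonempty :=
          Finset.insert_nonempty _ _
        refine ⟨(insert 0 (B.filter fun b => 0 < b ∧ b < (q : ℝ))).max' hne, ?_, ?_, ?_⟩
        · exact Finset.le_max' _ _ (Finset.mem_insert_self _ _)
        · rw [Finset.max'_lt_iff]
          intro x hx
          rcases Finset.mem_insert.1 hx with rfl | hx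
          · exact hq0
          · exact (Finset.mem_filter.1 hx).2.2
        · intro b' hb' hm
          have hb'q : b' < q := lt_of_le_of_ne hm.2 fun h =>
            hqB (h ▸ Finset.mem_insert_of_mem hb')
          have hb'0 : 0 < b' :=
            (Finset.le_max' _ _ (Finset.mem_insert_self _ _)).trans_lt hm.1
          exact absurd hm.1 (not_lt.2 (Finset.le_max' _ _
            (Finset.mem_insert_of_mem (Finset.mem_filter.2 ⟨hb', hb'0, hb'q⟩))))
      obtain ⟨l, d, -, h3⟩ := hf ⟨a, ha0, haq.trans q.2.2⟩
      have pl : (0 : ℝ) < 2 ^ l := by positivity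
      have e5 := h3 q haq.le ha
      -- two points with the same image, at distance `δ / 2 ^ k` and `δ / 2 ^ l` from `b` and `q`
      have two : ∀ δ : ℝ, 0 < δ → δ ≤ 2 ^ k * (b - s) → δ ≤ 2 ^ l * (q - a) →
          b - δ / 2 ^ k = q - δ / 2 ^ l := by
        intro δ hδ hδ1 hδ2
        have i1 : δ / 2 ^ k ≤ b - s := (div_le_iff₀' pk).2 hδ1
        have i2 : δ / 2 ^ l ≤ q - a := (div_le_iff₀' pl).2 hδ2
        have i3 : 0 < δ / 2 ^ k := by positivity
        have i4 : 0 < δ / 2 ^ l := by positivity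
        have m1 : b - δ / 2 ^ k ∈ Set.Ico (0 : ℝ) 1 :=
          ⟨by linarith [s.2.1], by linarith⟩
        have m2 : q - δ / 2 ^ l ∈ Set.Ico (0 : ℝ) 1 :=
          ⟨by linarith, by linarith [q.2.2]⟩
        have j1 := aff _ m1 (by linarith) (by linarith)
        have j2 := h3 ⟨_, m2⟩ (show a ≤ _ by linarith) fun b' hb' hm =>
          ha b' hb' ⟨hm.1, hm.2.trans (show _ ≤ (q : ℝ) by linarith)⟩
        have : f ⟨_, m1⟩ = f ⟨_, m2⟩ := by
          apply Subtype.ext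
          rw [j1, j2, mul_sub, mul_sub, mul_div_cancel₀ _ pk.ne', mul_div_cancel₀ _ pl.ne']
          linarith
        exact congrArg Subtype.val (f.injective this)
      obtain ⟨δ, hδ, k1, k2⟩ : ∃ δ : ℝ, 0 < δ ∧ δ ≤ 2 ^ k * (b - s) ∧ δ ≤ 2 ^ l * (q - a) :=
        ⟨min (2 ^ k * (b - s)) (2 ^ l * (q - a)),
          lt_min (mul_pos pk (by linarith)) (mul_pos pl (by linarith)),
          min_le_left _ _, min_le_right _ _⟩
      have t1 := two δ hδ k1 k2
      have t2 := two (δ / 2) (by linarith) (by linarith) (by linarith)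
      rw [div_right_comm δ 2 (2 ^ k), div_right_comm δ 2 (2 ^ l)] at t2
      exact hqb (by linarith)

/-- Thompson's group `V`: the group (under composition) of all bijections of `[0, 1)` which are
piecewise affine with finitely many breakpoints, all of them dyadic, with slopes integral powers of
`2`, right-continuous, and map dyadic rationals to dyadic rationals. -/
def ThompsonV : Subgroup (Equiv.Perm (Set.Ico (0 : ℝ) 1)) where
  carrier := {f | IsPiecewiseDyadic f}
  one_mem' := isPiecewiseDyadic_id
  mul_mem' := IsPiecewiseDyadic.comp
  inv_mem' := IsPiecewiseDyadic.inv

/-! The group is generated by finitely many involutions, namely swaps of two disjoint standard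
dyadic intervals of length 1/8 or 1/16 (`closure_smallSwaps`). In a tree, subtrees that meet
pairwise have a common vertex, so it suffices that each generator fixes a vertex and that any two
generators share one (`hasPropertyFA_of_involutions`).

Single generators: a swap is the swap of the left halves times the swap of the right halves, and
these factors are conjugate (`exists_coneSwap_eq_mul_conj`). Displacement parity is additive and
invariant under conjugation, so a swap moves every vertex an even distance and fixes the midpoint
between a vertex and its image.

Pairs `s`, `t`: together they touch at most four of the eight intervals of length 1/8, so some
conjugate of `s * t` is supported off them and commutes with both (`exists_conj_commute`). If the
fixed subtrees were disjoint, that conjugate would preserve both, hence fix the ends of the bridge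
between them. So `s * t` fixes a vertex `q`, that is, `s q = t q`, and the midpoint of `q` and `s q`
is fixed by both: a contradiction. -/

namespace SimpleGraph

/-! ### Geodesics and medians in trees. -/

variable {X : Type*} {Γ : SimpleGraph X}

theorem dist_comm_apply (Γ : SimpleGraph X) (x y : X) : Γ.dist x y = Γ.dist y x := dist_comm

theorem Connected.exists_dist_eq (hΓ : Γ.Connected) {x y : X} {k : ℕ} (hk : k ≤ Γ.dist x y) :
    ∃ m, Γ.dist x m = k ∧ Γ.dist x m + Γ.dist m y = Γ.dist x y := by
  obtain ⟨w, hw⟩ := hΓ.exists_walk_length_eq_dist x y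
  have h1 := Γ.dist_le (w.take k)
  have h2 := Γ.dist_le (w.drop k)
  have h3 := hΓ.dist_triangle (u := x) (v := w.getVert k) (w := y)
  rw [Walk.take_length] at h1
  rw [Walk.drop_length] at h2
  refine ⟨w.getVert k, ?_, ?_⟩ <;> omega

/-- Joining geodesics at an intermediate vertex gives a path from `x` to `y`. A tree has only one
such path, and the distance from `x` is the index along it. -/
theorem IsTree.eq_of_dist_eq (hΓ : Γ.IsTree) {x y u v : X}
    (hu : Γ.dist x u + Γ.dist u y = Γ.dist x y) (hv : Γ.dist x v + Γ.dist v y = Γ.dist x y)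
    (h : Γ.dist x u = Γ.dist x v) : u = v := by
  have key : ∀ z, Γ.dist x z + Γ.dist z y = Γ.dist x y →
      ∃ w : Γ.Walk x y, w.IsPath ∧ w.getVert (Γ.dist x z) = z := by
    intro z hz
    obtain ⟨w₁, h₁⟩ := hΓ.connected.exists_walk_length_eq_dist x z
    obtain ⟨w₂, h₂⟩ := hΓ.connected.exists_walk_length_eq_dist z y
    refine ⟨w₁.append w₂, Walk.isPath_of_length_eq_dist _ ?_, ?_⟩
    · rw [Walk.length_append, h₁, h₂, hz]
    · rw [Walk.getVert_append, h₁]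
      simp
  obtain ⟨w, hw, hwu⟩ := key u hu
  obtain ⟨w', hw', hwv⟩ := key v hv
  have := congrArg Subtype.val ((hΓ.isAcyclic.subsingleton_path x y).elim ⟨w, hw⟩ ⟨w', hw'⟩)
  dsimp only at this
  rw [← hwu, ← hwv, this, h]

/-- A tree is bipartite: each step of a walk changes the distance to any given vertex by exactly
one. -/
theorem IsTree.even_dist_add (hΓ : Γ.IsTree) (x y z : X) :
    Even (Γ.dist x y + Γ.dist y z + Γ.dist x z) := by
  obtain ⟨w⟩ := hΓ.connected.preconnected x z
  induction w using Walk.concatRec with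
  | Hnil => simp [Γ.dist_comm_apply y]
  | Hconcat w h ih =>
    rename_i a b c
    have h1 := hΓ.dist_eq_dist_add_one_of_adj y h
    have h2 := hΓ.dist_eq_dist_add_one_of_adj a h
    rw [Nat.even_iff] at ih ⊢
    omega

/-- If the edge from `x` to `p` points towards `y` and away from `z`, then `x` lies between `y` and
`z`. -/
theorem IsTree.dist_add_dist_of_adj (hΓ : Γ.IsTree) {x p z : X} (hxp : Γ.Adj x p)
    (hz : Γ.dist p z = Γ.dist x z + 1) :
    ∀ (n : ℕ) (y : X), Γ.dist p y = n → Γ.dist x y = n + 1 →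
      Γ.dist y z = Γ.dist x y + Γ.dist x z := by
  have hc := hΓ.connected
  intro n
  induction n with
  | zero =>
    intro y hy hxy
    rw [hc.dist_eq_zero_iff] at hy
    subst hy
    omega
  | succ n ih =>
    intro y hy hxy
    obtain ⟨q, hq1, hq2⟩ := hc.exists_dist_eq (x := p) (y := y) (k := n) (by omega)
    have hqy : Γ.dist q y = 1 := by omega
    have hxq : Γ.dist x q = n + 1 := by
      have h1 := hc.dist_triangle (u := x) (v := q) (w := y)
      have h2 := hc.dist_triangle (u := x) (v := p) (w := q)
      have h3 := dist_eq_one_iff_adj.2 hxp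
      omega
    have hqz := ih q hq1 hxq
    rcases hΓ.dist_eq_dist_add_one_of_adj z (dist_eq_one_iff_adj.1 hqy) with h | h
    -- If `y` were nearer to `z` than `q`, it would be the neighbour `r` of `q` on the way back to
    -- `x`; but `r` is at distance `n` from `x`, and `y` at distance `n + 2`.
    · exfalso
      obtain ⟨r, hr1, hr2⟩ := hc.exists_dist_eq (x := x) (y := q) (k := n) (by omega)
      have h4 := hc.dist_triangle (u := r) (v := x) (w := z)
      have h5 := hc.dist_triangle (u := q) (v := r) (w := z)
      rw [Γ.dist_comm_apply z, Γ.dist_comm_apply z] at h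
      rw [Γ.dist_comm_apply r x] at h4
      rw [Γ.dist_comm_apply q r] at h5
      have : y = r := hΓ.eq_of_dist_eq (x := q) (y := z) (by omega)
        (by rw [Γ.dist_comm_apply q r]; omega) (by rw [Γ.dist_comm_apply q r]; omega)
      subst this
      omega
    · rw [Γ.dist_comm_apply z, Γ.dist_comm_apply z] at h
      omega

/-- Walk from `x` towards `y` as long as the distance to `z` drops. Where it first grows, or on
arrival at `y`, stands the median. -/
theorem IsTree.exists_median (hΓ : Γ.IsTree) (x y z : X) :
    ∃ m, Γ.dist x m + Γ.dist m y = Γ.dist x y ∧ Γ.dist x m + Γ.dist m z = Γ.dist x z ∧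
      Γ.dist y m + Γ.dist m z = Γ.dist y z := by
  have hc := hΓ.connected
  obtain ⟨n, hn⟩ : ∃ n, Γ.dist x y = n := ⟨_, rfl⟩
  induction n generalizing x with
  | zero =>
    rw [hc.dist_eq_zero_iff] at hn
    subst hn
    exact ⟨x, by simp⟩
  | succ n ih =>
    obtain ⟨p, hp1, hp2⟩ := hc.exists_dist_eq (x := x) (y := y) (k := 1) (by omega)
    have hxp := dist_eq_one_iff_adj.1 hp1
    have := hΓ.dist_eq_dist_add_one_of_adj z hxp
    rw [Γ.dist_comm_apply z, Γ.dist_comm_apply z] at this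
    rcases this with h | h
    · obtain ⟨m, h1, h2, h3⟩ := ih p (by omega)
      have h4 := hc.dist_triangle (u := x) (v := p) (w := m)
      have h5 := hc.dist_triangle (u := x) (v := m) (w := y)
      have h6 := hc.dist_triangle (u := x) (v := m) (w := z)
      exact ⟨m, by omega, by omega, h3⟩
    · have := hΓ.dist_add_dist_of_adj hxp h n y (by omega) hn
      exact ⟨x, by simp, by simp, by rw [Γ.dist_comm_apply y x]; omega⟩

/-! ### Convex sets: Helly property and bridges. -/

/-- A set of vertices is geodesically convex if it contains every geodesic between its members. -/
def GeodesicallyConvex (Γ : SimpleGraph X) (A : Set X) : Prop :=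
  ∀ ⦃x⦄, x ∈ A → ∀ ⦃y⦄, y ∈ A → ∀ ⦃m⦄, Γ.dist x m + Γ.dist m y = Γ.dist x y → m ∈ A

theorem GeodesicallyConvex.inter {A B : Set X} (hA : Γ.GeodesicallyConvex A)
    (hB : Γ.GeodesicallyConvex B) : Γ.GeodesicallyConvex (A ∩ B) :=
  fun _ hx _ hy _ hm => ⟨hA hx.1 hy.1 hm, hB hx.2 hy.2 hm⟩

/-- The median of one point from each pairwise intersection lies in all three sets. -/
theorem IsTree.inter_inter_nonempty (hΓ : Γ.IsTree) {A B C : Set X}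
    (hA : Γ.GeodesicallyConvex A) (hB : Γ.GeodesicallyConvex B) (hC : Γ.GeodesicallyConvex C)
    (hAB : (A ∩ B).Nonempty) (hAC : (A ∩ C).Nonempty) (hBC : (B ∩ C).Nonempty) :
    (A ∩ B ∩ C).Nonempty := by
  obtain ⟨x, hx⟩ := hAB
  obtain ⟨y, hy⟩ := hAC
  obtain ⟨z, hz⟩ := hBC
  obtain ⟨m, h1, h2, h3⟩ := hΓ.exists_median x y z
  exact ⟨m, ⟨hA hx.1 hy.1 h1, hB hx.2 hz.1 h2⟩, hC hy.2 hz.2 h3⟩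

/-- The Helly property of subtrees of a tree. -/
theorem IsTree.exists_mem_of_pairwise_inter (hΓ : Γ.IsTree) {ι : Type*} (s : Finset ι)
    (C : ι → Set X) (hC : ∀ i ∈ s, Γ.GeodesicallyConvex (C i))
    (h : ∀ i ∈ s, ∀ j ∈ s, (C i ∩ C j).Nonempty) :
    ∀ K, Γ.GeodesicallyConvex K → K.Nonempty → (∀ i ∈ s, (K ∩ C i).Nonempty) →
      ∃ x ∈ K, ∀ i ∈ s, x ∈ C i := by
  classical
  induction s using Finset.induction_on with
  | empty => exact fun K _ ⟨x, hx⟩ _ => ⟨x, hx, by simp⟩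
  | insert a s _ ih =>
    intro K hK _ hKC
    simp only [Finset.forall_mem_insert] at hC h hKC ⊢
    -- `K` accumulates the sets already treated; the three-set case shows that `K ∩ C a` still meets
    -- every remaining set.
    obtain ⟨x, hx, hxs⟩ := ih hC.2 (fun i hi j hj => (h.2 i hi).2 j hj) (K ∩ C a)
      (hK.inter hC.1) hKC.1 fun i hi =>
        hΓ.inter_inter_nonempty hK hC.1 (hC.2 i hi) hKC.1 (hKC.2 i hi) (h.1.2 i hi)
    exact ⟨x, hx.1, hx.2, hxs⟩

/-- The bridge between two disjoint subtrees is unique. -/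
theorem IsTree.eq_of_dist_minimal (hΓ : Γ.IsTree) {A B : Set X}
    (hA : Γ.GeodesicallyConvex A) (hB : Γ.GeodesicallyConvex B) (hAB : Disjoint A B)
    {a a' b b' : X} (ha : a ∈ A) (ha' : a' ∈ A) (hb : b ∈ B) (hb' : b' ∈ B)
    (hmin : ∀ x ∈ A, ∀ y ∈ B, Γ.dist a b ≤ Γ.dist x y) (h : Γ.dist a' b' = Γ.dist a b) :
    a = a' := by
  have hc := hΓ.connected
  -- the ends of a bridge are gates
  have gate : ∀ {A B : Set X} {a a' b : X}, Γ.GeodesicallyConvex A → a ∈ A → a' ∈ A → b ∈ B →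
      (∀ x ∈ A, ∀ y ∈ B, Γ.dist a b ≤ Γ.dist x y) →
      Γ.dist a' a + Γ.dist a b = Γ.dist a' b := by
    intro A B a a' b hA ha ha' hb hmin
    obtain ⟨m, h1, h2, h3⟩ := hΓ.exists_median a' a b
    have h4 := hmin m (hA ha' ha h1) b hb
    have h5 : a = m := hc.dist_eq_zero_iff.1 (by omega)
    rw [h5]
    exact h2
  have hmin' : ∀ x ∈ A, ∀ y ∈ B, Γ.dist a' b' ≤ Γ.dist x y := by rwa [h]
  have h1 := gate hA ha ha' hb hmin
  have h2 := gate hA ha' ha hb' hmin'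
  have h3 := gate (A := B) (B := A) (a := b') (a' := b) (b := a') hB hb' hb ha' (by
    intro x hx y hy
    rw [Γ.dist_comm_apply b', Γ.dist_comm_apply x]
    exact hmin' y hy x hx)
  have c1 := Γ.dist_comm_apply a a'
  have c2 := Γ.dist_comm_apply b b'
  have c3 := Γ.dist_comm_apply b' a'
  have c4 := Γ.dist_comm_apply b a'
  -- Both `a` and `b'` lie on the geodesic from `a'` to `b`. If `a` comes no later than `b'`, it
  -- lies between `a'` and `b'`, and the gate property of `a'` forces `a = a'`. Otherwise `b'` lies
  -- between two points of `A`, against disjointness.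
  rcases le_or_gt (Γ.dist a' a) (Γ.dist a' b') with h4 | h4
  · obtain ⟨u, hu1, hu2⟩ := hc.exists_dist_eq h4
    have h5 := hc.dist_triangle (u := a') (v := u) (w := b)
    have h6 := hc.dist_triangle (u := u) (v := b') (w := b)
    have h7 : u = a := hΓ.eq_of_dist_eq (x := a') (y := b) (by omega) h1 hu1
    subst h7
    exact hc.dist_eq_zero_iff.1 (by omega)
  · exfalso
    obtain ⟨u, hu1, hu2⟩ := hc.exists_dist_eq h4.le
    have h5 := hc.dist_triangle (u := a') (v := u) (w := b)
    have h6 := hc.dist_triangle (u := u) (v := a) (w := b)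
    have h7 : u = b' := hΓ.eq_of_dist_eq (x := a') (y := b) (by omega) (by omega) hu1
    subst h7
    exact Set.disjoint_left.1 hAB (hA ha' ha hu2) hb'

/-! ### Automorphisms of trees. -/

theorem Iso.dist_map (φ : Γ ≃g Γ) (hΓ : Γ.Connected) (x y : X) :
    Γ.dist (φ x) (φ y) = Γ.dist x y := by
  have key : ∀ (ψ : Γ ≃g Γ) (x y : X), Γ.dist (ψ x) (ψ y) ≤ Γ.dist x y := by
    intro ψ x y
    obtain ⟨w, hw⟩ := hΓ.exists_walk_length_eq_dist x y
    rw [← hw, ← Walk.length_map ψ.toHom w]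
    exact Γ.dist_le _
  refine le_antisymm (key φ x y) ?_
  simpa using key φ.symm (φ x) (φ y)

theorem IsTree.geodesicallyConvex_fixed (hΓ : Γ.IsTree) (φ : Γ ≃g Γ) :
    Γ.GeodesicallyConvex {x | φ x = x} := by
  intro x hx y hy m hm
  have h1 := φ.dist_map hΓ.connected x m
  have h2 := φ.dist_map hΓ.connected m y
  rw [Set.mem_ofPred_eq] at hx hy ⊢
  rw [hx] at h1
  rw [hy] at h2
  exact hΓ.eq_of_dist_eq (by rw [h1, h2, hm]) hm h1

/-- A shortest bridge from `A` to `B` is mapped to another one, so by uniqueness its end in `A` is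
fixed. -/
theorem IsTree.exists_fixed_of_disjoint (hΓ : Γ.IsTree) (φ : Γ ≃g Γ) {A B : Set X}
    (hA : Γ.GeodesicallyConvex A) (hB : Γ.GeodesicallyConvex B) (hAB : Disjoint A B)
    (hA' : A.Nonempty) (hB' : B.Nonempty) (hφA : Set.MapsTo φ A A) (hφB : Set.MapsTo φ B B) :
    ∃ x, φ x = x := by
  obtain ⟨p, hp, hmin⟩ : ∃ p ∈ A ×ˢ B, ∀ q ∈ A ×ˢ B, Γ.dist p.1 p.2 ≤ Γ.dist q.1 q.2 := by
    obtain ⟨n, ⟨p, hp, rfl⟩, hn⟩ := WellFounded.has_min (wellFounded_lt (α := ℕ))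
      ((fun p : X × X => Γ.dist p.1 p.2) '' (A ×ˢ B)) ((hA'.prod hB').image _)
    exact ⟨p, hp, fun q hq => not_lt.1 (hn _ ⟨q, hq, rfl⟩)⟩
  refine ⟨p.1, (hΓ.eq_of_dist_minimal hA hB hAB hp.1 (hφA hp.1) hp.2 (hφB hp.2) ?_
    (φ.dist_map hΓ.connected _ _)).symm⟩
  exact fun x hx y hy => hmin (x, y) ⟨hx, hy⟩

/-- An automorphism which interchanges two vertices at even distance fixes their midpoint. -/
theorem IsTree.exists_midpoint (hΓ : Γ.IsTree) {x y : X} (h : Even (Γ.dist x y)) :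
    ∃ m, ∀ φ : Γ ≃g Γ, φ x = y → φ y = x → φ m = m := by
  obtain ⟨n, hn⟩ := h
  obtain ⟨m, hm1, hm2⟩ := hΓ.connected.exists_dist_eq (x := x) (y := y) (k := n) (by omega)
  refine ⟨m, fun φ hx hy => ?_⟩
  have h1 := φ.dist_map hΓ.connected x m
  have h2 := φ.dist_map hΓ.connected m y
  rw [hx, Γ.dist_comm] at h1
  rw [hy, Γ.dist_comm] at h2
  exact hΓ.eq_of_dist_eq (x := x) (y := y) (by omega) hm2 (by omega)

/-- Displacement parity does not depend on the vertex: an automorphism either preserves or exchanges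
the two colour classes. -/
theorem IsTree.even_dist_add_dist (hΓ : Γ.IsTree) (φ : Γ ≃g Γ) (x y : X) :
    Even (Γ.dist x (φ x) + Γ.dist y (φ y)) := by
  have h1 := hΓ.even_dist_add x (φ x) (φ y)
  have h2 := hΓ.even_dist_add x y (φ y)
  rw [φ.dist_map hΓ.connected] at h1
  rw [Nat.even_iff] at *
  omega

end SimpleGraph

/-! ### The fixed-point criterion. -/

/-- The vertex `x`, as a point of the geometric realization. -/
noncomputable def GraphPoint.vertex {X : Type*} (Γ : SimpleGraph X) (x : X) : GraphPoint Γ where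
  coord := Finsupp.single x 1
  nonneg v := by
    classical
    rw [Finsupp.single_apply]
    split_ifs <;> norm_num
  total := by simp
  simplex := Or.inl ⟨x, by simp⟩

theorem GraphPoint.map_vertex {X : Type*} {Γ : SimpleGraph X} (φ : Γ ≃g Γ) (x : X) :
    (GraphPoint.vertex Γ x).map φ = GraphPoint.vertex Γ (φ x) := by
  apply GraphPoint.ext
  simp [GraphPoint.map, GraphPoint.vertex]

open SimpleGraph in
/-- A variant of Serre's criterion, for groups generated by finitely many involutions. -/
theorem hasPropertyFA_of_involutions {G : Type v} [Group G] {T : Set G} (hfin : T.Finite)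
    (hT : Subgroup.closure T = ⊤) (hinv : ∀ s ∈ T, s * s = 1)
    (heven : ∀ s ∈ T, ∃ g k, s = g * (k * g * k⁻¹))
    (hcomm : ∀ s ∈ T, ∀ t ∈ T, ∃ k, Commute s (k * (s * t) * k⁻¹) ∧
      Commute t (k * (s * t) * k⁻¹)) :
    HasPropertyFA.{v, u} G := by
  intro X Γ hΓ ρ
  have hc := hΓ.connected
  have mul : ∀ g h x, ρ (g * h) x = ρ g (ρ h x) := fun g h x => by
    rw [map_mul]; rfl
  have one : ∀ x, ρ 1 x = x := fun x => by rw [map_one]; rfl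
  have inv_self : ∀ g x, ρ g (ρ g⁻¹ x) = x := fun g x => by rw [← mul, mul_inv_cancel, one]
  have self_inv : ∀ g x, ρ g⁻¹ (ρ g x) = x := fun g x => by rw [← mul, inv_mul_cancel, one]
  have sq : ∀ s ∈ T, ∀ x, ρ s (ρ s x) = x := fun s hs x => by rw [← mul, hinv s hs, one]
  -- The displacements of `g` and of its conjugate have the same parity, so that of their product is
  -- even.
  have even : ∀ s ∈ T, ∀ x, Even (Γ.dist x (ρ s x)) := by
    intro s hs x
    obtain ⟨g, k, rfl⟩ := heven s hs
    have h1 := hΓ.even_dist_add x (ρ g x) (ρ (g * (k * g * k⁻¹)) x)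
    have h2 := hΓ.even_dist_add_dist (ρ g) x (ρ k⁻¹ x)
    have h3 := (ρ k).dist_map hc (ρ k⁻¹ x) (ρ g (ρ k⁻¹ x))
    rw [inv_self] at h3
    rw [mul g, mul, mul, (ρ g).dist_map hc, h3] at h1
    rw [mul g, mul, mul]
    rw [Nat.even_iff] at *
    omega
  -- The second clause, on every `t` that agrees with `s` at `x`, is what later yields a common
  -- fixed vertex.
  have mid : ∀ s ∈ T, ∀ x, ∃ m, ρ s m = m ∧ ∀ t ∈ T, ρ t x = ρ s x → ρ t m = m := by
    intro s hs x
    obtain ⟨m, hm⟩ := hΓ.exists_midpoint (even s hs x)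
    exact ⟨m, hm _ rfl (sq s hs x), fun t ht h => hm _ h (by rw [← h, sq t ht])⟩
  obtain ⟨x₀⟩ := hc.nonempty
  have pair : ∀ s ∈ T, ∀ t ∈ T, ({x | ρ s x = x} ∩ {x | ρ t x = x}).Nonempty := by
    intro s hs t ht
    by_contra hne
    rw [Set.not_nonempty_iff_eq_empty, ← Set.disjoint_iff_inter_eq_empty] at hne
    obtain ⟨k, hk1, hk2⟩ := hcomm s hs t ht
    have maps : ∀ r, Commute r (k * (s * t) * k⁻¹) →
        Set.MapsTo (ρ (k * (s * t) * k⁻¹)) {x | ρ r x = x} {x | ρ r x = x} := by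
      intro r hr x hx
      rw [Set.mem_ofPred_eq] at hx ⊢
      rw [← mul, hr.eq, mul, hx]
    obtain ⟨p, hp⟩ := hΓ.exists_fixed_of_disjoint (ρ (k * (s * t) * k⁻¹))
      (hΓ.geodesicallyConvex_fixed (ρ s)) (hΓ.geodesicallyConvex_fixed (ρ t)) hne
      ((mid s hs x₀).imp fun _ h => h.1) ((mid t ht x₀).imp fun _ h => h.1)
      (maps s hk1) (maps t hk2)
    -- Since the conjugate fixes `p`, `s * t` fixes `k⁻¹ p`; as `s` is an involution, `s` and `t`
    -- then agree at `k⁻¹ p`.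
    have hq : ρ s (ρ t (ρ k⁻¹ p)) = ρ k⁻¹ p := by
      rw [mul, mul, mul] at hp
      rw [← self_inv k (ρ s (ρ t (ρ k⁻¹ p))), hp]
    obtain ⟨m, hm, hm'⟩ := mid s hs (ρ k⁻¹ p)
    refine Set.disjoint_left.1 hne hm (hm' t ht ?_)
    rw [← sq s hs (ρ t _), hq]
  obtain ⟨x, -, hx⟩ := hΓ.exists_mem_of_pairwise_inter hfin.toFinset (fun s => {x | ρ s x = x})
    (fun s _ => hΓ.geodesicallyConvex_fixed (ρ s))
    (fun s hs t ht => pair s (by simpa using hs) t (by simpa using ht))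
    Set.univ (fun _ _ _ _ _ _ => trivial) ⟨x₀, trivial⟩
    (fun s hs => by
      obtain ⟨m, hm, -⟩ := mid s (by simpa using hs) x₀
      exact ⟨m, trivial, hm⟩)
  refine ⟨GraphPoint.vertex Γ x, fun g => ?_⟩
  rw [GraphPoint.map_vertex]
  congr 1
  have hg : g ∈ Subgroup.closure T := hT ▸ Subgroup.mem_top g
  induction hg using Subgroup.closure_induction with
  | mem s hs => exact hx s (by simpa using hs)
  | one => exact one x
  | mul g h _ _ hg hh => rw [mul, hh, hg]
  | inv g _ hg => conv_lhs => rw [← hg, self_inv]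

/-! ### Standard dyadic intervals and the swaps of two of them -/

/-- The interval `[0, 1)`. -/
abbrev UnitIco : Type := Set.Ico (0 : ℝ) 1

/-- The affine bijection of `[0, 1)` onto its left or right half. -/
noncomputable def halfMap (b : Bool) (y : UnitIco) : UnitIco :=
  ⟨((cond b 1 0 : ℝ) + y) / 2, by
    have h := y.2
    rw [Set.mem_Ico] at h ⊢
    cases b <;> simp only [cond_true, cond_false] <;> constructor <;> linarith⟩

theorem coe_halfMap (b : Bool) (y : UnitIco) :
    (halfMap b y : ℝ) = ((cond b 1 0 : ℝ) + y) / 2 := rfl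

theorem halfMap_eq_halfMap {b c : Bool} {y z : UnitIco} (h : halfMap b y = halfMap c z) :
    b = c ∧ y = z := by
  have h' := congrArg Subtype.val h
  rw [coe_halfMap, coe_halfMap] at h'
  have hy := y.2
  have hz := z.2
  rw [Set.mem_Ico] at hy hz
  cases b <;> cases c <;> simp only [cond_true, cond_false] at h'
  · exact ⟨rfl, Subtype.ext (by linarith)⟩
  · exfalso; linarith
  · exfalso; linarith
  · exact ⟨rfl, Subtype.ext (by linarith)⟩

theorem exists_halfMap (y : UnitIco) : ∃ b z, halfMap b z = y := by
  have hy := y.2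
  rw [Set.mem_Ico] at hy
  by_cases h : (y : ℝ) < 1 / 2
  · exact ⟨false, ⟨2 * y, by constructor <;> linarith⟩, Subtype.ext (by simp [coe_halfMap])⟩
  · exact ⟨true, ⟨2 * y - 1, by constructor <;> linarith⟩, Subtype.ext (by simp [coe_halfMap])⟩

/-- The affine bijection of `[0, 1)` onto the standard dyadic interval with the address `α`. -/
noncomputable def cone : List Bool → UnitIco → UnitIco
  | [], y => y
  | b :: α, y => halfMap b (cone α y)

@[simp]
theorem cone_nil (y : UnitIco) : cone [] y = y := rfl

theorem cone_append (α β : List Bool) (y : UnitIco) : cone (α ++ β) y = cone α (cone β y) := by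
  induction α with
  | nil => rfl
  | cons b α ih => simp only [List.cons_append, cone, ih]

theorem cone_concat (α : List Bool) (b : Bool) (y : UnitIco) :
    cone (α ++ [b]) y = cone α (halfMap b y) := cone_append α [b] y

theorem cone_injective (α : List Bool) : Function.Injective (cone α) := by
  induction α with
  | nil => exact fun _ _ h => h
  | cons b α ih => exact fun _ _ h => ih (halfMap_eq_halfMap h).2

theorem prefix_or_prefix_of_cone_eq {α β : List Bool} {y z : UnitIco} (h : cone α y = cone β z) :
    α <+: β ∨ β <+: α := by
  induction α generalizing β with
  | nil => exact Or.inl (List.nil_prefix)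
  | cons b α ih =>
    cases β with
    | nil => exact Or.inr (List.nil_prefix)
    | cons c β =>
      obtain ⟨rfl, h'⟩ := halfMap_eq_halfMap h
      simpa using ih h'

theorem prefix_of_cone_eq {α β : List Bool} {y z : UnitIco} (h : cone α y = cone β z)
    (hl : α.length ≤ β.length) : α <+: β := by
  rcases prefix_or_prefix_of_cone_eq h with h | h
  · exact h
  · rw [h.eq_of_length_le hl]

theorem eq_of_cone_eq {α β : List Bool} {y z : UnitIco} (h : cone α y = cone β z)
    (hl : α.length = β.length) : α = β :=
  (prefix_of_cone_eq h hl.le).eq_of_length hl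

theorem exists_cone (n : ℕ) (y : UnitIco) : ∃ α z, α.length = n ∧ cone α z = y := by
  induction n generalizing y with
  | zero => exact ⟨[], y, rfl, rfl⟩
  | succ n ih =>
    obtain ⟨b, z, rfl⟩ := exists_halfMap y
    obtain ⟨α, w, h, rfl⟩ := ih z
    exact ⟨b :: α, w, by simp [h], rfl⟩

/-- Two addresses are incomparable if the corresponding intervals are disjoint. -/
def Incomparable (α β : List Bool) : Prop := ¬ α <+: β ∧ ¬ β <+: α

/-- The form of disjointness that can be transported along arbitrary bijections. -/
theorem incomparable_iff {α β : List Bool} :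
    Incomparable α β ↔ ∀ y z, cone α y ≠ cone β z := by
  constructor
  · intro h y z hyz
    exact (prefix_or_prefix_of_cone_eq hyz).elim h.1 h.2
  · intro h
    have y : UnitIco := ⟨0, by simp⟩
    constructor
    · rintro ⟨γ, rfl⟩
      exact h (cone γ y) y (cone_append _ _ _).symm
    · rintro ⟨γ, rfl⟩
      exact h y (cone γ y) (cone_append _ _ _)

theorem Incomparable.symm {α β : List Bool} (h : Incomparable α β) : Incomparable β α := ⟨h.2, h.1⟩

theorem Incomparable.append {α β : List Bool} (h : Incomparable α β) (γ δ : List Bool) :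
    Incomparable (α ++ γ) (β ++ δ) := by
  rw [incomparable_iff] at h ⊢
  intro y z
  rw [cone_append, cone_append]
  exact h _ _

theorem incomparable_of_length_eq {α β : List Bool} (hl : α.length = β.length) (h : α ≠ β) :
    Incomparable α β :=
  ⟨fun h' => h (h'.eq_of_length hl), fun h' => h (h'.eq_of_length hl.symm).symm⟩

open Classical in
/-- The map underlying `coneSwap`. -/
noncomputable def coneSwapFun (α β : List Bool) (y : UnitIco) : UnitIco :=
  if h : ∃ z, cone α z = y then cone β h.choose
  else if h : ∃ z, cone β z = y then cone α h.choose else y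

theorem coneSwapFun_left (α β : List Bool) (z : UnitIco) :
    coneSwapFun α β (cone α z) = cone β z := by
  have h : ∃ z', cone α z' = cone α z := ⟨z, rfl⟩
  rw [coneSwapFun, dif_pos h, cone_injective α h.choose_spec]

theorem coneSwapFun_right {α β : List Bool} (hαβ : Incomparable α β) (z : UnitIco) :
    coneSwapFun α β (cone β z) = cone α z := by
  have h : ∃ z', cone β z' = cone β z := ⟨z, rfl⟩
  rw [coneSwapFun, dif_neg, dif_pos h, cone_injective β h.choose_spec]
  rintro ⟨z', h'⟩
  exact incomparable_iff.1 hαβ _ _ h'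

theorem coneSwapFun_of_ne {α β : List Bool} {y : UnitIco} (hα : ∀ z, cone α z ≠ y)
    (hβ : ∀ z, cone β z ≠ y) : coneSwapFun α β y = y := by
  rw [coneSwapFun, dif_neg (not_exists.2 hα), dif_neg (not_exists.2 hβ)]

theorem cone_cases (α β : List Bool) (y : UnitIco) :
    (∃ z, cone α z = y) ∨ (∃ z, cone β z = y) ∨ (∀ z, cone α z ≠ y) ∧ ∀ z, cone β z ≠ y := by
  by_cases h1 : ∃ z, cone α z = y
  · exact Or.inl h1
  by_cases h2 : ∃ z, cone β z = y
  · exact Or.inr (Or.inl h2)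
  · exact Or.inr (Or.inr ⟨not_exists.1 h1, not_exists.1 h2⟩)

theorem coneSwapFun_involutive {α β : List Bool} (h : Incomparable α β) :
    Function.Involutive (coneSwapFun α β) := by
  intro y
  rcases cone_cases α β y with ⟨z, rfl⟩ | ⟨z, rfl⟩ | ⟨h1, h2⟩
  · rw [coneSwapFun_left, coneSwapFun_right h]
  · rw [coneSwapFun_right h, coneSwapFun_left]
  · rw [coneSwapFun_of_ne h1 h2, coneSwapFun_of_ne h1 h2]

/-- The involution which interchanges two disjoint standard dyadic intervals by affine maps. -/
noncomputable def coneSwap {α β : List Bool} (h : Incomparable α β) : Equiv.Perm UnitIco :=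
  (coneSwapFun_involutive h).toPerm

section

variable {α β : List Bool} (h : Incomparable α β)

@[simp]
theorem coneSwap_left (z : UnitIco) : coneSwap h (cone α z) = cone β z := coneSwapFun_left α β z

@[simp]
theorem coneSwap_right (z : UnitIco) : coneSwap h (cone β z) = cone α z := coneSwapFun_right h z

theorem coneSwap_of_ne {y : UnitIco} (hα : ∀ z, cone α z ≠ y) (hβ : ∀ z, cone β z ≠ y) :
    coneSwap h y = y := coneSwapFun_of_ne hα hβ

theorem coneSwap_of_incomparable {γ : List Bool} (hα : Incomparable α γ) (hβ : Incomparable β γ)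
    (z : UnitIco) : coneSwap h (cone γ z) = cone γ z :=
  coneSwap_of_ne h (fun _ => incomparable_iff.1 hα _ _) (fun _ => incomparable_iff.1 hβ _ _)

theorem coneSwap_mul_self : coneSwap h * coneSwap h = 1 :=
  Equiv.ext (coneSwapFun_involutive h)

theorem coneSwap_comm : coneSwap h = coneSwap h.symm := by
  ext1 y
  rcases cone_cases α β y with ⟨z, rfl⟩ | ⟨z, rfl⟩ | ⟨h1, h2⟩
  · simp
  · simp
  · rw [coneSwap_of_ne h h1 h2, coneSwap_of_ne h.symm h2 h1]

theorem incomparable_of_conj {k : Equiv.Perm UnitIco} {α' β' : List Bool}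
    (hα : ∀ z, k (cone α z) = cone α' z) (hβ : ∀ z, k (cone β z) = cone β' z) :
    Incomparable α β → Incomparable α' β' := by
  rw [incomparable_iff, incomparable_iff]
  intro h y z hyz
  rw [← hα, ← hβ] at hyz
  exact h _ _ (k.injective hyz)

/-- Only the behaviour of `k` on the two swapped intervals matters, because the swap is trivial
elsewhere. -/
theorem coneSwap_conj {k : Equiv.Perm UnitIco} {α' β' : List Bool}
    (hα : ∀ z, k (cone α z) = cone α' z) (hβ : ∀ z, k (cone β z) = cone β' z) :
    k * coneSwap h * k⁻¹ = coneSwap (incomparable_of_conj hα hβ h) := by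
  rw [mul_inv_eq_iff_eq_mul]
  ext1 y
  rw [Equiv.Perm.mul_apply, Equiv.Perm.mul_apply]
  rcases cone_cases α β y with ⟨z, rfl⟩ | ⟨z, rfl⟩ | ⟨h1, h2⟩
  · rw [coneSwap_left, hα, hβ, coneSwap_left]
  · rw [coneSwap_right, hα, hβ, coneSwap_right]
  · rw [coneSwap_of_ne h h1 h2, coneSwap_of_ne]
    · intro z hz
      rw [← hα] at hz
      exact h1 z (k.injective hz)
    · intro z hz
      rw [← hβ] at hz
      exact h2 z (k.injective hz)

/-- Affine maps respect halves. This serves both to lengthen addresses in the generation argument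
and to obtain even displacement. -/
theorem coneSwap_eq_mul :
    coneSwap h = coneSwap (h.append [false] [false]) * coneSwap (h.append [true] [true]) := by
  have key : ∀ b c z, coneSwap (h.append [b] [b]) (cone α (halfMap c z)) =
        cone (if b = c then β else α) (halfMap c z) ∧
      coneSwap (h.append [b] [b]) (cone β (halfMap c z)) =
        cone (if b = c then α else β) (halfMap c z) := by
    intro b c z
    rw [← cone_concat α c, ← cone_concat β c]
    by_cases hbc : b = c
    · subst hbc
      rw [coneSwap_left, coneSwap_right]
      simp [cone_concat]
    · have hi : ∀ γ : List Bool, Incomparable (γ ++ [b]) (γ ++ [c]) := fun γ =>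
        incomparable_of_length_eq (by simp) (by simpa using hbc)
      rw [coneSwap_of_incomparable _ (hi α) (h.symm.append [b] [c]),
        coneSwap_of_incomparable _ (h.append [b] [c]) (hi β)]
      simp [cone_concat, hbc]
  ext1 y
  rw [Equiv.Perm.mul_apply]
  rcases cone_cases α β y with ⟨z, rfl⟩ | ⟨z, rfl⟩ | ⟨h1, h2⟩
  · obtain ⟨b, z, rfl⟩ := exists_halfMap z
    rw [coneSwap_left, (key true b z).1]
    cases b <;> simp [key]
  · obtain ⟨b, z, rfl⟩ := exists_halfMap z
    rw [coneSwap_right, (key true b z).2]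
    cases b <;> simp [key]
  · have h3 : ∀ γ b z, (∀ z, cone γ z ≠ y) → cone (γ ++ [b]) z ≠ y := fun γ b z hγ => by
      rw [cone_concat]
      exact hγ _
    rw [coneSwap_of_ne h h1 h2, coneSwap_of_ne (h.append [true] [true]) (fun z => h3 α _ z h1)
      (fun z => h3 β _ z h2), coneSwap_of_ne _ (fun z => h3 α _ z h1) (fun z => h3 β _ z h2)]

end

/-! ### Thompson's group in terms of standard dyadic intervals -/

/-- The left end point of a standard dyadic interval. -/
noncomputable def coneStart (α : List Bool) : ℝ := cone α ⟨0, by simp⟩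

theorem coe_cone (α : List Bool) (y : UnitIco) :
    (cone α y : ℝ) = coneStart α + y / 2 ^ α.length := by
  induction α with
  | nil => simp [coneStart]
  | cons b α ih =>
    have h : coneStart (b :: α) = ((cond b 1 0 : ℝ) + coneStart α) / 2 := rfl
    rw [cone, coe_halfMap, ih, h, List.length_cons, pow_succ]
    field_simp
    ring

theorem exists_coneStart_eq (α : List Bool) : ∃ m : ℕ, coneStart α = m / 2 ^ α.length := by
  induction α with
  | nil => exact ⟨0, by simp [coneStart]⟩
  | cons b α ih =>
    obtain ⟨m, hm⟩ := ih
    have h : coneStart (b :: α) = ((cond b 1 0 : ℝ) + coneStart α) / 2 := rfl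
    refine ⟨cond b (2 ^ α.length) 0 + m, ?_⟩
    rw [h, hm, List.length_cons, pow_succ]
    cases b
    · simp [div_div]
    · push_cast [cond_true]
      field_simp

theorem isDyadic_coneStart (α : List Bool) : IsDyadic (coneStart α) := by
  obtain ⟨m, hm⟩ := exists_coneStart_eq α
  exact ⟨m, α.length, by rw [hm]; simp⟩

/-- The map `f` sends the standard dyadic intervals of length `2 ^ (-n)` to standard dyadic
intervals, by affine maps. -/
def MapsCones (f : Equiv.Perm UnitIco) (n : ℕ) : Prop :=
  ∀ α : List Bool, α.length = n → ∃ β, ∀ z, f (cone α z) = cone β z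

theorem MapsCones.isPiecewiseDyadic {f : Equiv.Perm UnitIco} {n : ℕ} (hf : MapsCones f n) :
    IsPiecewiseDyadic f := by
  classical
  refine ⟨(List.finite_length_eq Bool n).toFinset.image coneStart, ?_, ?_⟩
  · intro b hb
    obtain ⟨α, -, rfl⟩ := Finset.mem_image.1 hb
    exact isDyadic_coneStart α
  · intro s
    obtain ⟨α, z, hα, rfl⟩ := exists_cone n s
    obtain ⟨β, hβ⟩ := hf α hα
    refine ⟨n - β.length, 2 ^ ((n : ℤ) - β.length) * -coneStart α + coneStart β,
      ((isDyadic_coneStart α).neg.zpow_mul _).add (isDyadic_coneStart β), ?_⟩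
    intro t hst ht
    obtain ⟨γ, w, hγ, rfl⟩ := exists_cone n t
    have hw := w.2
    have hz := z.2
    rw [Set.mem_Ico] at hw hz
    have hst' : (cone α z : ℝ) ≤ cone γ w := hst
    -- The left end of the interval of `t` is not in `(s, t]`, so it is at most `s`, and `s` lies in
    -- the same interval.
    have : α = γ := by
      have hγs := ht (coneStart γ) (Finset.mem_image_of_mem _ (by simpa using hγ))
      rw [Set.mem_Ioc, not_and_or, not_lt, not_le] at hγs
      have p : (0 : ℝ) < 2 ^ n := by positivity
      rcases hγs with h | h
      · have hz' : ((cone α z : ℝ) - coneStart γ) * 2 ^ n ∈ Set.Ico (0 : ℝ) 1 := by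
          constructor
          · exact mul_nonneg (by linarith) p.le
          · rw [← lt_div_iff₀ p]
            rw [coe_cone γ, hγ] at hst'
            have : (w : ℝ) / 2 ^ n < 1 / 2 ^ n := div_lt_div_of_pos_right hw.2 p
            linarith
        have h' : cone α z = cone γ ⟨_, hz'⟩ := Subtype.ext (by
          rw [coe_cone γ, hγ]
          field_simp
          ring)
        exact eq_of_cone_eq h' (hα.trans hγ.symm)
      · exfalso
        rw [coe_cone γ] at h
        have : (0 : ℝ) ≤ w / 2 ^ γ.length := div_nonneg hw.1 (by positivity)
        linarith
    subst this
    rw [hβ, coe_cone, coe_cone, hα, zpow_sub₀ (by norm_num), zpow_natCast, zpow_natCast]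
    field_simp
    ring

/-- At the level of the longer address, every interval lies inside one of the swapped intervals or
is disjoint from both. -/
theorem coneSwap_mem {α β : List Bool} (h : Incomparable α β) : coneSwap h ∈ ThompsonV := by
  refine MapsCones.isPiecewiseDyadic (n := max α.length β.length) fun γ hγ => ?_
  by_cases hα : α <+: γ
  · obtain ⟨δ, rfl⟩ := hα
    exact ⟨β ++ δ, fun z => by rw [cone_append, cone_append, coneSwap_left]⟩
  by_cases hβ : β <+: γ
  · obtain ⟨δ, rfl⟩ := hβ
    exact ⟨α ++ δ, fun z => by rw [cone_append, cone_append, coneSwap_right]⟩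
  refine ⟨γ, coneSwap_of_incomparable h ⟨hα, fun h' => hα ?_⟩ ⟨hβ, fun h' => hβ ?_⟩⟩
  · rw [h'.eq_of_length_le (by omega)]
  · rw [h'.eq_of_length_le (by omega)]

theorem exists_cone_eq_of_mul_eq {x : UnitIco} {p : ℕ} {m : ℤ} (hx : (x : ℝ) * 2 ^ p = m) :
    ∃ α : List Bool, α.length = p ∧ coneStart α = x := by
  obtain ⟨α, z, rfl, rfl⟩ := exists_cone p x
  refine ⟨α, rfl, ?_⟩
  obtain ⟨k, hk⟩ := exists_coneStart_eq α
  have hz := z.2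
  rw [Set.mem_Ico] at hz
  rw [coe_cone, hk] at hx ⊢
  have h1 : (k : ℝ) + z = m := by
    rw [← hx]
    field_simp
  have h2 : (k : ℤ) ≤ m := by
    have : ((k : ℤ) : ℝ) ≤ m := by push_cast; linarith
    exact_mod_cast this
  have h3 : m < (k : ℤ) + 1 := by
    have : (m : ℝ) < ((k : ℤ) + 1 : ℤ) := by push_cast; linarith
    exact_mod_cast this
  have h4 : m = k := by omega
  rw [h4] at h1
  push_cast at h1
  have h5 : (z : ℝ) = 0 := by linarith
  rw [h5]
  simp

theorem exists_uniform_denominator (B : Finset ℝ) (hB : ∀ b ∈ B, IsDyadic b) :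
    ∃ n : ℕ, ∀ k, n ≤ k → ∀ b ∈ B, ∃ m : ℤ, b * 2 ^ k = m := by
  classical
  induction B using Finset.induction_on with
  | empty => exact ⟨0, by simp⟩
  | insert a B _ ih =>
    obtain ⟨n, hn⟩ := ih fun b hb => hB b (Finset.mem_insert_of_mem hb)
    obtain ⟨m, l, rfl⟩ := hB a (Finset.mem_insert_self _ _)
    refine ⟨max n l, fun k hk b hb => ?_⟩
    rcases Finset.mem_insert.1 hb with rfl | hb
    · obtain ⟨j, rfl⟩ := Nat.exists_eq_add_of_le ((le_max_right _ _).trans hk)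
      exact ⟨m * 2 ^ j, by push_cast; rw [pow_add]; field_simp⟩
    · exact hn k ((le_max_left _ _).trans hk) b hb

theorem IsPiecewiseDyadic.exists_mapsCones {f : Equiv.Perm UnitIco} (hf : IsPiecewiseDyadic f) :
    ∃ n, MapsCones f n := by
  classical
  obtain ⟨B, hB, hf⟩ := hf
  obtain ⟨n, hn⟩ := exists_uniform_denominator B hB
  -- `f` is affine on intervals of length `2 ^ (-n)`
  have aff : ∀ α : List Bool, ∃ (k : ℤ) (c : ℝ), IsDyadic c ∧
      (α.length = n → ∀ z, (f (cone α z) : ℝ) = 2 ^ k * (cone α z : ℝ) + c) := by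
    intro α
    obtain ⟨k, c, hc, h⟩ := hf (cone α ⟨0, by simp⟩)
    refine ⟨k, c, hc, fun hα z => h _ ?_ ?_⟩
    · change (cone α _ : ℝ) ≤ cone α z
      rw [coe_cone, coe_cone]
      have := z.2.1
      gcongr
    · intro b hb hm
      obtain ⟨m, hm'⟩ := hn n le_rfl b hb
      obtain ⟨j, hj⟩ := exists_coneStart_eq α
      have p : (0 : ℝ) < 2 ^ n := by positivity
      have hz := z.2.2
      change coneStart α < b ∧ b ≤ (cone α z : ℝ) at hm
      rw [coe_cone, hj, hα, ← mul_lt_mul_iff_left₀ p,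
        ← mul_le_mul_iff_left₀ p, hm'] at hm
      have e : ((j : ℝ) / 2 ^ n + z / 2 ^ n) * 2 ^ n = j + z := by field_simp
      have e' : (j : ℝ) / 2 ^ n * 2 ^ n = j := by field_simp
      rw [e, e'] at hm
      have h1 : (j : ℤ) < m := by exact_mod_cast hm.1
      have h2 : m < (j : ℤ) + 1 := by
        have : (m : ℝ) < ((j : ℤ) + 1 : ℤ) := by push_cast; linarith
        exact_mod_cast this
      omega
  choose k c hc haff using aff
  have hfin := List.finite_length_eq Bool n
  obtain ⟨l, hl⟩ := exists_uniform_denominator (hfin.toFinset.image c) (by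
    intro b hb
    obtain ⟨α, -, rfl⟩ := Finset.mem_image.1 hb
    exact hc α)
  obtain ⟨K, hK⟩ : ∃ K : ℕ, ∀ α : List Bool, α.length = n → k α ≤ K := by
    refine ⟨hfin.toFinset.sup fun α => (k α).toNat, fun α hα => ?_⟩
    have := Finset.le_sup (f := fun α => (k α).toNat) (hfin.mem_toFinset.2 hα)
    omega
  -- An interval of this level has an image of length `2 ^ (-p)` with `p = n + (l + K) - k α ≥ l`.
  -- Hence `c α`, and with it the left end of the image, is an integral multiple of `2 ^ (-p)`,
  -- which makes the image standard.
  refine ⟨n + (l + K), fun γ hγ => ?_⟩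
  obtain ⟨α, δ, hα, hδ, rfl⟩ : ∃ α δ : List Bool, α.length = n ∧ δ.length = l + K ∧ γ = α ++ δ :=
    ⟨γ.take n, γ.drop n, by simp [hγ], by simp [hγ], by simp⟩
  have hkα := hK α hα
  obtain ⟨p, hp⟩ : ∃ p : ℕ, (p : ℤ) = n + (l + K) - k α := ⟨(n + (l + K) - k α).toNat, by omega⟩
  have h1 : ∀ z, (f (cone (α ++ δ) z) : ℝ) = (2 ^ k α * coneStart (α ++ δ) + c α) + z / 2 ^ p := by
    intro z
    rw [cone_append, haff α hα, ← cone_append, coe_cone, hγ]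
    have : (2 : ℝ) ^ k α * 2 ^ p = 2 ^ (n + (l + K)) := by
      rw [← zpow_natCast, ← zpow_natCast, ← zpow_add₀ (by norm_num), hp]
      congr 1
      push_cast
      ring
    rw [← this]
    have : (2 : ℝ) ^ k α ≠ 0 := by positivity
    field_simp
    ring
  obtain ⟨j, hj⟩ := exists_coneStart_eq (α ++ δ)
  obtain ⟨m, hm⟩ := hl p (by omega) (c α) (Finset.mem_image_of_mem _ (by simpa using hα))
  obtain ⟨β, hβ, hβ'⟩ := exists_cone_eq_of_mul_eq (x := f (cone (α ++ δ) ⟨0, by simp⟩)) (p := p)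
    (m := j + m) (by
      rw [h1, zero_div, add_zero, add_mul, hm, hj, hγ]
      have : (2 : ℝ) ^ k α * 2 ^ p = 2 ^ (n + (l + K)) := by
        rw [← zpow_natCast, ← zpow_natCast, ← zpow_add₀ (by norm_num), hp]
        congr 1
        push_cast
        ring
      rw [mul_right_comm, this]
      push_cast
      field_simp)
  refine ⟨β, fun z => Subtype.ext ?_⟩
  rw [h1, coe_cone, hβ, hβ', h1]
  simp

/-! ### Generation of Thompson's group by finitely many swaps -/

/-- The addresses of the standard dyadic intervals of length `2 ^ (-n)`. -/
abbrev Word (n : ℕ) : Type := {α : List Bool // α.length = n}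

instance (n : ℕ) : Fintype (Word n) := inferInstanceAs (Fintype (List.Vector Bool n))

theorem card_word (n : ℕ) : Fintype.card (Word n) = 2 ^ n := by
  rw [← Fintype.card_bool]
  exact card_vector n

/-- The swaps of two disjoint standard dyadic intervals of length `1 / 8` or `1 / 16`. -/
def smallSwaps : Set (Equiv.Perm UnitIco) :=
  {f | ∃ (α β : List Bool) (h : Incomparable α β), (3 ≤ α.length ∧ α.length ≤ 4) ∧
    (3 ≤ β.length ∧ β.length ≤ 4) ∧ f = coneSwap h}

theorem smallSwaps_finite : smallSwaps.Finite := by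
  classical
  have hfin := List.finite_length_le Bool 4
  refine (hfin.image2 (fun α β => if h : Incomparable α β then coneSwap h else 1) hfin).subset ?_
  rintro f ⟨α, β, h, hα, hβ, rfl⟩
  exact ⟨α, hα.2, β, hβ.2, dif_pos h⟩

theorem exists_length_three_ne (α β : List Bool) :
    ∃ γ : List Bool, γ.length = 3 ∧ γ ≠ α ∧ γ ≠ β := by
  by_contra! h
  have h' : ∀ γ : List Bool, γ.length = 3 → γ = α ∨ γ = β := fun γ hγ =>
    or_iff_not_imp_left.2 (h γ hγ)
  have key : ∀ a b c : List Bool, a ≠ b → a ≠ c → b ≠ c → (a = α ∨ a = β) → (b = α ∨ b = β) →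
      (c = α ∨ c = β) → False := by grind
  exact key [false, false, false] [false, false, true] [false, true, true] (by decide) (by decide)
    (by decide) (h' _ rfl) (h' _ rfl) (h' _ rfl)

/-- Conjugate by the small swap of `δ`, the first four letters of `β`, with an address `ε` of length
three disjoint from `α` and `δ`: `β` loses a letter and `α` does not grow. Hence both lengths 3 and
4 occur among the generators. -/
theorem coneSwap_mem_closure_of_lt {α β : List Bool} (h : Incomparable α β) (hα : 3 ≤ α.length)
    (hβ : 4 < β.length)
    (ih : ∀ (α' β' : List Bool) (h' : Incomparable α' β'), 3 ≤ α'.length → 3 ≤ β'.length →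
      α'.length + β'.length < α.length + β.length →
      coneSwap h' ∈ Subgroup.closure smallSwaps) :
    coneSwap h ∈ Subgroup.closure smallSwaps := by
  obtain ⟨δ, γ, hδ, hγ, rfl⟩ : ∃ δ γ : List Bool, δ.length = 4 ∧ 0 < γ.length ∧ β = δ ++ γ :=
    ⟨β.take 4, β.drop 4, by simp; omega, by simp; omega, by simp⟩
  obtain ⟨ε, hε, hεα, hεδ⟩ := exists_length_three_ne (α.take 3) (δ.take 3)
  have inc : ∀ ζ : List Bool, 3 ≤ ζ.length → ε ≠ ζ.take 3 → Incomparable ζ ε := by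
    intro ζ hζ hne
    have h1 : Incomparable (ζ.take 3) ε :=
      incomparable_of_length_eq (by simp; omega) hne.symm
    simpa using h1.append (ζ.drop 3) []
  have hδε := inc δ (by omega) hεδ
  have hk : coneSwap hδε ∈ Subgroup.closure smallSwaps :=
    Subgroup.subset_closure ⟨δ, ε, hδε, by omega, by omega, rfl⟩
  have hβ' : ∀ z, coneSwap hδε (cone (δ ++ γ) z) = cone (ε ++ γ) z := fun z => by
    rw [cone_append, coneSwap_left, cone_append]
  obtain ⟨α', hα', hl, hl'⟩ : ∃ α' : List Bool, (∀ z, coneSwap hδε (cone α z) = cone α' z) ∧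
      3 ≤ α'.length ∧ α'.length ≤ α.length := by
    by_cases hp : δ <+: α
    · obtain ⟨η, rfl⟩ := hp
      exact ⟨ε ++ η, fun z => by rw [cone_append, coneSwap_left, cone_append], by simp; omega,
        by simp; omega⟩
    -- Here `α` is disjoint from `δ` as well: a prefix of `δ` would be a prefix of `β`.
    · refine ⟨α, coneSwap_of_incomparable _ ⟨hp, fun h' => h.1 ?_⟩ (inc α hα hεα).symm, hα, le_rfl⟩
      exact h'.trans (List.prefix_append _ _)
  have := ih α' (ε ++ γ) (incomparable_of_conj hα' hβ' h) hl (by simp; omega) (by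
    simp only [List.length_append]; omega)
  rw [← coneSwap_conj h hα' hβ'] at this
  rwa [Subgroup.mul_mem_cancel_right _ (Subgroup.inv_mem _ hk),
    Subgroup.mul_mem_cancel_left _ hk] at this

theorem coneSwap_mem_closure_of_three_le (n : ℕ) : ∀ (α β : List Bool) (h : Incomparable α β),
    3 ≤ α.length → 3 ≤ β.length → α.length + β.length = n →
      coneSwap h ∈ Subgroup.closure smallSwaps := by
  induction n using Nat.strong_induction_on with
  | _ n ih =>
    intro α β h hα hβ hn
    by_cases hβ' : 4 < β.length
    · exact coneSwap_mem_closure_of_lt h hα hβ' fun α' β' h' h1 h2 h3 =>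
        ih _ (by omega) α' β' h' h1 h2 rfl
    by_cases hα' : 4 < α.length
    · rw [coneSwap_comm]
      exact coneSwap_mem_closure_of_lt h.symm hβ hα' fun α' β' h' h1 h2 h3 =>
        ih _ (by omega) α' β' h' h1 h2 rfl
    · exact Subgroup.subset_closure ⟨α, β, h, by omega, by omega, rfl⟩

theorem coneSwap_mem_closure {α β : List Bool} (h : Incomparable α β) :
    coneSwap h ∈ Subgroup.closure smallSwaps := by
  have key : ∀ (k : ℕ) (α β : List Bool) (h : Incomparable α β), 3 ≤ α.length + k →
      3 ≤ β.length + k → coneSwap h ∈ Subgroup.closure smallSwaps := by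
    intro k
    induction k with
    | zero => exact fun α β h hα hβ => coneSwap_mem_closure_of_three_le _ α β h hα hβ rfl
    | succ k ih =>
      intro α β h hα hβ
      rw [coneSwap_eq_mul]
      exact Subgroup.mul_mem _ (ih _ _ _ (by simp; omega) (by simp; omega))
        (ih _ _ _ (by simp; omega) (by simp; omega))
  -- Three halvings bring any address to length at least three.
  exact key 3 α β h (by omega) (by omega)

/-! ### Partitions into standard dyadic intervals. -/

/-- The standard dyadic intervals with the addresses `d i`, `i ∈ s`, form a partition. -/
def IsConePartition {ι : Type*} (s : Finset ι) (d : ι → List Bool) : Prop :=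
  ∀ y, ∃! i, i ∈ s ∧ ∃ z, cone (d i) z = y

namespace IsConePartition

variable {ι : Type*} {s : Finset ι} {d : ι → List Bool}

theorem eq_of_cone_eq (hd : IsConePartition s d) {i j : ι} (hi : i ∈ s) (hj : j ∈ s)
    {y z : UnitIco} (h : cone (d i) y = cone (d j) z) : i = j :=
  (hd (cone (d i) y)).unique ⟨hi, y, rfl⟩ ⟨hj, z, h.symm⟩

theorem incomparable (hd : IsConePartition s d) {i j : ι} (hi : i ∈ s) (hj : j ∈ s)
    (h : i ≠ j) : Incomparable (d i) (d j) :=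
  incomparable_iff.2 fun _ _ h' => h (hd.eq_of_cone_eq hi hj h')

theorem nonempty (hd : IsConePartition s d) : s.Nonempty := by
  obtain ⟨i, ⟨hi, -⟩, -⟩ := hd ⟨0, by simp⟩
  exact ⟨i, hi⟩

theorem eq_nil (hd : IsConePartition s d) {i : ι} (hi : s = {i}) : d i = [] := by
  subst hi
  cases h : d i with
  | nil => rfl
  | cons b α =>
    obtain ⟨j, ⟨hj, z, hz⟩, -⟩ := hd (halfMap (!b) ⟨0, by simp⟩)
    rw [Finset.mem_singleton] at hj
    rw [hj, h] at hz
    have := (halfMap_eq_halfMap hz).1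
    simp at this

/-- A partition into at least two intervals contains both halves of some interval. -/
theorem exists_siblings (hd : IsConePartition s d) (hs : 1 < s.card) :
    ∃ γ, ∃ i ∈ s, ∃ j ∈ s, d i = γ ++ [false] ∧ d j = γ ++ [true] := by
  -- Take a longest address. The part that meets its sibling interval is no longer, so it is the
  -- sibling itself or an ancestor; an ancestor would also contain the interval of `i`.
  obtain ⟨i, hi, hmax⟩ := s.exists_max_image (fun i => (d i).length) hd.nonempty
  obtain ⟨i', hi', hne⟩ := Finset.exists_mem_ne hs i
  have hnil : d i ≠ [] := by
    intro h
    have := (hd.incomparable hi hi' hne.symm).1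
    rw [h] at this
    exact this List.nil_prefix
  obtain ⟨γ, b, hγ⟩ : ∃ γ b, d i = γ ++ [b] := ⟨_, _, (List.dropLast_append_getLast hnil).symm⟩
  obtain ⟨j, ⟨hj, z, hz⟩, -⟩ := hd (cone (γ ++ [!b]) ⟨0, by simp⟩)
  have hlen : (d j).length ≤ (γ ++ [!b]).length := by
    have := hmax j hj
    rw [hγ] at this
    simpa using this
  have hj' : d j = γ ++ [!b] := by
    rcases List.prefix_concat_iff.1 (prefix_of_cone_eq hz hlen) with h | h
    · exact h
    · exfalso
      have hp : d j <+: d i := by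
        rw [hγ]
        exact h.trans (List.prefix_append _ _)
      have hji : j = i := by
        by_contra hji
        exact (hd.incomparable hj hi hji).1 hp
      rw [hji, hγ] at h
      have := h.length_le
      simp at this
  cases b
  · exact ⟨γ, i, hi, j, hj, hγ, hj'⟩
  · exact ⟨γ, j, hj, i, hi, hj', hγ⟩

theorem contract [DecidableEq ι] (hd : IsConePartition s d) {i j : ι} (hi : i ∈ s) (hj : j ∈ s)
    {γ : List Bool} (hdi : d i = γ ++ [false]) (hdj : d j = γ ++ [true]) :
    IsConePartition (s.erase j) (Function.update d i γ) := by
  have hij : i ≠ j := by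
    rintro rfl
    rw [hdi] at hdj
    simp at hdj
  have hγ : ∀ z, ∃ l, (l = i ∨ l = j) ∧ ∃ w, cone (d l) w = cone γ z := by
    intro z
    obtain ⟨b, w, rfl⟩ := exists_halfMap z
    cases b
    · exact ⟨i, Or.inl rfl, w, by rw [hdi, cone_concat]⟩
    · exact ⟨j, Or.inr rfl, w, by rw [hdj, cone_concat]⟩
  intro y
  obtain ⟨l, ⟨hl, z, hz⟩, hu⟩ := hd y
  by_cases hlij : l = i ∨ l = j
  · have hy : ∃ w, cone γ w = y := by
      rcases hlij with rfl | rfl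
      · exact ⟨halfMap false z, by rw [← hz, hdi, cone_concat]⟩
      · exact ⟨halfMap true z, by rw [← hz, hdj, cone_concat]⟩
    refine ⟨i, ⟨Finset.mem_erase.2 ⟨hij, hi⟩, by simpa using hy⟩, ?_⟩
    rintro m ⟨hm, w, hw⟩
    by_contra hmi
    rw [Function.update_of_ne hmi] at hw
    rw [Finset.mem_erase] at hm
    have := hu m ⟨hm.2, w, hw⟩
    subst this
    exact hlij.elim hmi hm.1
  · rw [not_or] at hlij
    refine ⟨l, ⟨Finset.mem_erase.2 ⟨hlij.2, hl⟩, z, by rwa [Function.update_of_ne hlij.1]⟩, ?_⟩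
    rintro m ⟨hm, w, hw⟩
    rw [Finset.mem_erase] at hm
    by_cases hmi : m = i
    · exfalso
      subst hmi
      rw [Function.update_self] at hw
      obtain ⟨l', hl', w', hw'⟩ := hγ w
      have : l' = l := hu l' ⟨by rcases hl' with rfl | rfl <;> assumption, w', hw'.trans hw⟩
      subst this
      exact hl'.elim hlij.1 hlij.2
    · rw [Function.update_of_ne hmi] at hw
      exact hu m ⟨hm.2, w, hw⟩

theorem comp_swap [DecidableEq ι] (hd : IsConePartition s d) {i j : ι} (hi : i ∈ s)
    (hj : j ∈ s) : IsConePartition s (d ∘ Equiv.swap i j) := by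
  have hmem : ∀ l ∈ s, Equiv.swap i j l ∈ s := by
    intro l hl
    rw [Equiv.swap_apply_def]
    split_ifs <;> assumption
  intro y
  obtain ⟨l, ⟨hl, z, hz⟩, hu⟩ := hd y
  refine ⟨Equiv.swap i j l, ⟨hmem l hl, z, by simpa using hz⟩, ?_⟩
  rintro m ⟨hm, w, hw⟩
  rw [← hu _ ⟨hmem m hm, w, hw⟩, Equiv.swap_apply_self]

theorem exists_mem_closure_comp_swap [DecidableEq ι] (hd : IsConePartition s d) {i j : ι}
    (hi : i ∈ s) (hj : j ∈ s) : ∃ g ∈ Subgroup.closure smallSwaps, ∀ l ∈ s, ∀ z,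
      g (cone (d l) z) = cone ((d ∘ Equiv.swap i j) l) z := by
  by_cases hij : i = j
  · subst hij
    exact ⟨1, Subgroup.one_mem _, by simp⟩
  · refine ⟨coneSwap (hd.incomparable hi hj hij), coneSwap_mem_closure _, fun l hl z => ?_⟩
    rw [Function.comp_apply, Equiv.swap_apply_def]
    split_ifs with h1 h2
    · rw [h1, coneSwap_left]
    · rw [h2, coneSwap_right]
    · exact coneSwap_of_incomparable _ (hd.incomparable hi hl (Ne.symm h1))
        (hd.incomparable hj hl (Ne.symm h2)) z

end IsConePartition

/-- Induction on the number of intervals. Two swaps of target intervals make a sibling pair of `d`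
go to a sibling pair of `r`, in order; the map is then affine on the parent, and both pairs can be
merged. -/
theorem mem_closure_of_isConePartition {ι : Type*} (n : ℕ) :
    ∀ (s : Finset ι) (d r : ι → List Bool) (f : Equiv.Perm UnitIco), s.card = n + 1 →
      IsConePartition s d → IsConePartition s r →
      (∀ i ∈ s, ∀ z, f (cone (d i) z) = cone (r i) z) → f ∈ Subgroup.closure smallSwaps := by
  classical
  induction n with
  | zero =>
    intro s d r f hs hd hr hf
    obtain ⟨i, hi⟩ := Finset.card_eq_one.1 hs
    have hf1 : f = 1 := by
      ext1 z
      simpa [hd.eq_nil hi, hr.eq_nil hi] using hf i (by simp [hi]) z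
    rw [hf1]
    exact Subgroup.one_mem _
  | succ n ih =>
    intro s d r f hs hd hr hf
    obtain ⟨γ, i, hi, j, hj, hdi, hdj⟩ := hd.exists_siblings (by omega)
    obtain ⟨δ, i', hi', j', hj', hri, hrj⟩ := hr.exists_siblings (by omega)
    have hij : i ≠ j := by
      rintro rfl
      rw [hdi] at hdj
      simp at hdj
    -- match the two pairs of siblings by permuting the intervals of the partition `r`
    obtain ⟨g, hg, hgf⟩ := hr.exists_mem_closure_comp_swap hi hi'
    have hr₁ := hr.comp_swap hi hi'
    obtain ⟨r₁, hr₁'⟩ : ∃ r₁, r₁ = r ∘ Equiv.swap i i' := ⟨_, rfl⟩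
    rw [← hr₁'] at hgf hr₁
    have hr₁i : r₁ i = δ ++ [false] := by simp [hr₁', hri]
    obtain ⟨k, hk, hr₁k⟩ : ∃ k ∈ s, r₁ k = δ ++ [true] := by
      refine ⟨Equiv.swap i i' j', ?_, by simp [hr₁', hrj]⟩
      rw [Equiv.swap_apply_def]
      split_ifs <;> assumption
    -- Ensures that the second swap leaves the matched left sibling in place.
    have hik : i ≠ k := by
      rintro rfl
      rw [hr₁i] at hr₁k
      simp at hr₁k
    obtain ⟨g', hg', hgf'⟩ := hr₁.exists_mem_closure_comp_swap hj hk
    have hr₂ := hr₁.comp_swap hj hk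
    obtain ⟨r₂, hr₂'⟩ : ∃ r₂, r₂ = r₁ ∘ Equiv.swap j k := ⟨_, rfl⟩
    rw [← hr₂'] at hgf' hr₂
    have hr₂i : r₂ i = δ ++ [false] := by
      rw [hr₂', Function.comp_apply, Equiv.swap_apply_of_ne_of_ne hij hik, hr₁i]
    have hr₂j : r₂ j = δ ++ [true] := by simp [hr₂', hr₁k]
    have hF : ∀ l ∈ s, ∀ z, (g' * (g * f)) (cone (d l) z) = cone (r₂ l) z := by
      intro l hl z
      rw [Equiv.Perm.mul_apply, Equiv.Perm.mul_apply, hf l hl, hgf l hl, hgf' l hl]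
    have := ih (s.erase j) _ _ (g' * (g * f))
      (by rw [Finset.card_erase_of_mem hj, hs]; rfl)
      (hd.contract hi hj hdi hdj) (hr₂.contract hi hj hr₂i hr₂j) (by
        intro l hl z
        by_cases hli : l = i
        · subst hli
          rw [Function.update_self, Function.update_self]
          obtain ⟨b, w, rfl⟩ := exists_halfMap z
          rw [← cone_concat, ← cone_concat]
          cases b
          · rw [← hdi, ← hr₂i, hF l hi]
          · rw [← hdj, ← hr₂j, hF j hj]
        · rw [Function.update_of_ne hli, Function.update_of_ne hli,
            hF l (Finset.mem_of_mem_erase hl)])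
    rwa [Subgroup.mul_mem_cancel_left _ hg', Subgroup.mul_mem_cancel_left _ hg] at this

theorem closure_smallSwaps : Subgroup.closure smallSwaps = ThompsonV := by
  apply le_antisymm
  · rw [Subgroup.closure_le]
    rintro f ⟨α, β, h, -, -, rfl⟩
    exact coneSwap_mem h
  · intro f hf
    obtain ⟨n, hn⟩ := IsPiecewiseDyadic.exists_mapsCones hf
    choose r hr using hn
    have hd : IsConePartition (Finset.univ : Finset (Word n)) Subtype.val := by
      intro y
      obtain ⟨α, z, hα, hz⟩ := exists_cone n y
      refine ⟨⟨α, hα⟩, ⟨Finset.mem_univ _, z, hz⟩, ?_⟩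
      rintro ⟨β, hβ⟩ ⟨-, w, hw⟩
      exact Subtype.ext (eq_of_cone_eq (hw.trans hz.symm) (hβ.trans hα.symm))
    refine mem_closure_of_isConePartition _ Finset.univ Subtype.val
      (fun i : Word n => r i.1 i.2) f
      (Nat.succ_pred_eq_of_pos (Finset.card_pos.2 hd.nonempty)).symm hd ?_
      fun i _ z => hr i.1 i.2 z
    intro y
    obtain ⟨x, rfl⟩ := f.surjective y
    obtain ⟨i, ⟨hi, z, rfl⟩, -⟩ := hd x
    refine ⟨i, ⟨hi, z, (hr i.1 i.2 z).symm⟩, ?_⟩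
    rintro j ⟨hj, w, hw⟩
    rw [← hr j.1 j.2] at hw
    exact hd.eq_of_cone_eq hj hi (f.injective hw)

/-! ### Property FA -/

/-- Take for `g` the swap of the left halves, and for `k` the map exchanging the two halves inside
each of `α` and `β`; it conjugates `g` to the swap of the right halves. -/
theorem exists_coneSwap_eq_mul_conj {α β : List Bool} (h : Incomparable α β) :
    ∃ g ∈ ThompsonV, ∃ k ∈ ThompsonV, coneSwap h = g * (k * g * k⁻¹) := by
  have hi : ∀ γ : List Bool, Incomparable (γ ++ [false]) (γ ++ [true]) := fun γ =>
    incomparable_of_length_eq (by simp) (by simp)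
  refine ⟨_, coneSwap_mem (h.append [false] [false]), coneSwap (hi α) * coneSwap (hi β),
    ThompsonV.mul_mem (coneSwap_mem _) (coneSwap_mem _), ?_⟩
  rw [coneSwap_conj (α' := α ++ [true]) (β' := β ++ [true]), ← coneSwap_eq_mul]
  · intro z
    rw [Equiv.Perm.mul_apply, coneSwap_of_incomparable _ (h.symm.append _ _)
      (h.symm.append _ _), coneSwap_left]
  · intro z
    rw [Equiv.Perm.mul_apply, coneSwap_left, coneSwap_of_incomparable _ (h.append _ _)
      (h.append _ _)]

theorem exists_mem_thompsonV_of_perm {n : ℕ} (σ : Equiv.Perm (Word n)) :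
    ∃ k ∈ ThompsonV, ∀ w z, k (cone w.1 z) = cone (σ w).1 z := by
  induction σ using Equiv.Perm.swap_induction_on with
  | one => exact ⟨1, ThompsonV.one_mem, by simp⟩
  | swap_mul σ v w hvw ih =>
    obtain ⟨k, hk, hk'⟩ := ih
    have hi : ∀ {v w : Word n}, v ≠ w → Incomparable v.1 w.1 := fun {v w} hne =>
      incomparable_of_length_eq (v.2.trans w.2.symm) fun h => hne (Subtype.ext h)
    refine ⟨coneSwap (hi hvw) * k, ThompsonV.mul_mem (coneSwap_mem _) hk, fun l z => ?_⟩
    rw [Equiv.Perm.mul_apply, hk', Equiv.Perm.mul_apply, Equiv.swap_apply_def]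
    split_ifs with h1 h2
    · rw [h1, coneSwap_left]
    · rw [h2, coneSwap_right]
    · exact coneSwap_of_incomparable _ (hi (Ne.symm h1)) (hi (Ne.symm h2)) z

/-- The complement has room for a copy of `A`; extend a bijection onto that copy to a permutation.
-/
theorem exists_perm_displacing {W : Type*} [Fintype W] [DecidableEq W] {A : Finset W}
    (hA : 2 * A.card ≤ Fintype.card W) : ∃ σ : Equiv.Perm W, ∀ w ∈ A, σ w ∉ A := by
  obtain ⟨B, hB, hBA⟩ := Finset.exists_subset_card_eq (s := Aᶜ) (n := A.card)
    (by rw [Finset.card_compl]; omega)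
  have e : {w // w ∈ A} ≃ {w // w ∈ B} := Finset.equivOfCardEq hBA.symm
  exact ⟨e.extendSubtype, fun w hw => Finset.mem_compl.1 (hB (e.extendSubtype_mem w hw))⟩

/-- Addresses of length at least three put each swapped interval inside a single interval of length
1/8. -/
theorem exists_support_of_mem_smallSwaps {s : Equiv.Perm UnitIco} (hs : s ∈ smallSwaps) :
    ∃ A : Finset (Word 3), A.card ≤ 2 ∧
      ∀ w ∉ A, ∀ z, s (cone w.1 z) = cone w.1 z := by
  classical
  obtain ⟨α, β, h, hα, hβ, rfl⟩ := hs
  refine ⟨{⟨α.take 3, by simp; omega⟩, ⟨β.take 3, by simp; omega⟩}, Finset.card_le_two, ?_⟩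
  intro w hw z
  simp only [Finset.mem_insert, Finset.mem_singleton, not_or] at hw
  have inc : ∀ ζ : List Bool, 3 ≤ ζ.length → w.1 ≠ ζ.take 3 → Incomparable ζ w.1 := by
    intro ζ hζ hne
    have h1 : Incomparable (ζ.take 3) w.1 :=
      incomparable_of_length_eq (by rw [w.2]; simp; omega) hne.symm
    simpa using h1.append (ζ.drop 3) []
  exact coneSwap_of_incomparable h (inc α hα.1 fun h' => hw.1 (Subtype.ext h'))
    (inc β hβ.1 fun h' => hw.2 (Subtype.ext h')) z

theorem exists_conj_commute {s t : Equiv.Perm UnitIco} (hs : s ∈ smallSwaps)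
    (ht : t ∈ smallSwaps) : ∃ k ∈ ThompsonV, Commute s (k * (s * t) * k⁻¹) ∧
      Commute t (k * (s * t) * k⁻¹) := by
  classical
  obtain ⟨A, hA, hsA⟩ := exists_support_of_mem_smallSwaps hs
  obtain ⟨B, hB, htB⟩ := exists_support_of_mem_smallSwaps ht
  -- The supports cover at most 2 + 2 of the 8 intervals, exactly the half that displacement allows.
  obtain ⟨σ, hσ⟩ := exists_perm_displacing (A := A ∪ B) (by
    have h1 := Finset.card_union_le A B
    have h2 : Fintype.card (Word 3) = 8 := card_word 3
    omega)
  obtain ⟨k, hk, hkσ⟩ := exists_mem_thompsonV_of_perm σ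
  -- An interval of `A ∪ B` is the `k`-image of one outside `A ∪ B`, where `s * t` is trivial. So
  -- the conjugate has support disjoint from those of `s` and `t`.
  have key : ∀ w, w ∈ A ∪ B → ∀ z, (k * (s * t) * k⁻¹) (cone w.1 z) = cone w.1 z := by
    intro w hw z
    obtain ⟨v, rfl⟩ := σ.surjective w
    have hv : v ∉ A ∪ B := fun hv => hσ v hv hw
    rw [Finset.mem_union, not_or] at hv
    have hinv : ∀ x, k⁻¹ (k x) = x := k.symm_apply_apply
    rw [← hkσ, Equiv.Perm.mul_apply, hinv, Equiv.Perm.mul_apply,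
      Equiv.Perm.mul_apply, htB v hv.2, hsA v hv.1]
  refine ⟨k, hk, Equiv.Perm.Disjoint.commute fun y => ?_, Equiv.Perm.Disjoint.commute fun y => ?_⟩
  all_goals
    obtain ⟨α, z, hα, rfl⟩ := exists_cone 3 y
    by_cases hw : (⟨α, hα⟩ : Word 3) ∈ A ∪ B
    · exact Or.inr (key _ hw z)
    · rw [Finset.mem_union, not_or] at hw
      first
        | exact Or.inl (hsA _ hw.1 z)
        | exact Or.inl (htB _ hw.2 z)

theorem theorem4p4 : HasPropertyFA.{0, u} ThompsonV := by
  refine hasPropertyFA_of_involutions (T := ((↑) : ThompsonV → Equiv.Perm UnitIco) ⁻¹' smallSwaps)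
    (smallSwaps_finite.preimage Subtype.val_injective.injOn) ?_ ?_ ?_ ?_
  · have := Subgroup.closure_closure_coe_preimage (k := smallSwaps)
    rwa [closure_smallSwaps] at this
  · rintro ⟨s, hsV⟩ ⟨α, β, h, -, -, rfl⟩
    exact Subtype.ext (coneSwap_mul_self h)
  · rintro ⟨s, hsV⟩ ⟨α, β, h, -, -, rfl⟩
    obtain ⟨g, hg, k, hk, hgk⟩ := exists_coneSwap_eq_mul_conj h
    exact ⟨⟨g, hg⟩, ⟨k, hk⟩, Subtype.ext hgk⟩
  · rintro s hs t ht
    obtain ⟨k, hk, h1, h2⟩ := exists_conj_commute hs ht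
    exact ⟨⟨k, hk⟩, Subtype.ext h1.eq, Subtype.ext h2.eq⟩
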